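/- Let $\lambda\ge 3$, $M=2^{\lambda}$, and let $\mathcal S=\{e^{j(2m-1)\pi/M}: m=1,\dots,M\}\subset\mathbb C$ be the $M$-PSK signal set. A nonzero complex number $s$ is called a singular fade state for $\mathcal S$ if there are two distinct pairs $(x_A,x_B)\neq(x_A',x_B')$ in $\mathcal S\times\mathcal S$ with $x_A+sx_B=x_A'+sx_B'$. A singularity removal constraint for $s$ is a nonempty set $c\subseteq\mathcal S\times\mathcal S$ such that $x_A+sx_B=x_A'+sx_B'$ for all $(x_A,x_B),(x_A',x_B')\in c$, and $x_A+sx_B\neq x_A'+sx_B'$ whenever $(x_A,x_B)\in c$ and $(x_A',x_B')\notin c$. The singularity removal graph $\mathcal G_s$ is the simple graph whose vertices are the singularity removal constraints for $s$, two distinct constraints $c,c'$ being adjacent if and only if there are $(x_A,x_B)\in c$ and $(x_A',x_B')\in c'$ with $x_A=x_A'$ or $x_B=x_B'$. A Latin square on $\mathcal S$ is an array with rows and columns indexed by $\mathcal S$, one symbol in each cell, in which no symbol is repeated in any row or in any column; it removes $s$ if all cells belonging to the same singularity removal constraint for $s$ contain the same symbol. Then for every singular fade state $s$ of $\mathcal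 S$: (i) there is a Latin square on $\mathcal S$ that contains exactly $M$ symbols and removes $s$; (ii) $\mathcal G_s$ is $M$-colourable: it has a proper vertex colouring that uses exactly $M$ colours. -/

import Mathlib

namespace TwoWayRelay

/-- The `M`-PSK signal set `{e^{j(2m-1)π/M} : m ∈ {1, …, M}}`. -/
def psk (M : ℕ) : Set ℂ :=
  {z | ∃ m ∈ Finset.Icc 1 M,
    z = Complex.exp ((((2 * (m : ℝ) - 1) * Real.pi / (M : ℝ) : ℝ) : ℂ) * Complex.I)}

/-- The point `x_A + s x_B` of the effective constellation at the relay (normalized by the fade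
coefficient `H_A`), for the fade state `s = H_B / H_A` and the transmitted pair `(x_A, x_B)`. -/
def effectivePoint {S : Set ℂ} (s : ℂ) (p : S × S) : ℂ :=
  (p.1 : ℂ) + s * (p.2 : ℂ)

/-- A fade state `s = H_B / H_A` (a nonzero complex number, both links being present) is singular
for the signal set `S` if the minimum distance of the effective constellation is zero, i.e. two
different transmitted pairs give the same point. -/
def IsSingularFadeState (S : Set ℂ) (s : ℂ) : Prop :=
  s ≠ 0 ∧ ∃ p q : S × S, p ≠ q ∧ effectivePoint s p = effectivePoint s q

/-- A singularity removal constraint: a nonempty set of cells on which `x_A + s x_B` is constant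
and which contains every cell with that value. -/
def IsRemovalConstraint (S : Set ℂ) (s : ℂ) (c : Set (S × S)) : Prop :=
  c.Nonempty ∧
  (∀ p ∈ c, ∀ q ∈ c, effectivePoint s p = effectivePoint s q) ∧
  (∀ p ∈ c, ∀ q ∉ c, effectivePoint s p ≠ effectivePoint s q)

/-- The set `𝒞(s)` of singularity removal constraints, as a type. -/
abbrev RemovalConstraint (S : Set ℂ) (s : ℂ) : Type :=
  {c : Set (S × S) // IsRemovalConstraint S s c}

/-- The singularity removal graph: its vertices are the singularity removal constraints; two
different ones are adjacent iff they have cells in a common row or in a common column. -/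
def removalGraph (S : Set ℂ) (s : ℂ) : SimpleGraph (RemovalConstraint S s) where
  Adj c d := c ≠ d ∧ ∃ p ∈ c.1, ∃ q ∈ d.1, p.1 = q.1 ∨ p.2 = q.2
  symm := ⟨by
    rintro c d ⟨hne, p, hp, q, hq, h⟩
    exact ⟨hne.symm, q, hq, p, hp, h.imp Eq.symm Eq.symm⟩⟩
  loopless := ⟨fun _ h => h.1 rfl⟩

/-- A Latin square with rows and columns indexed by the signal set `S` and symbols in `T` (a map
obeying the exclusive law): no symbol repeats in a row or in a column. -/
structure LatinSquare (S : Set ℂ) (T : Type) where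
  /-- The symbol in the cell `(x_A, x_B)`. -/
  entry : S × S → T
  row_exclusion : ∀ a b b' : S, b ≠ b' → entry (a, b) ≠ entry (a, b')
  col_exclusion : ∀ a a' b : S, a ≠ a' → entry (a, b) ≠ entry (a', b)

/-- A Latin square removes the fade state `s` if all cells that belong to the same singularity
removal constraint are filled with the same symbol. -/
def LatinSquare.Removes {S : Set ℂ} {T : Type} (L : LatinSquare S T) (s : ℂ) : Prop :=
  ∀ c : Set (S × S), IsRemovalConstraint S s c → ∀ p ∈ c, ∀ q ∈ c, L.entry p = L.entry q

end TwoWayRelay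

/-! The signal set is a rotated copy of the powers of a root of unity `ω` of order `M = 2 ^ n`, so
cells are pairs in `ZMod (2 ^ n)`, and a Latin array constant on collisions `ω ^ a + s ω ^ b = ω ^
a' + s ω ^ b'` is needed. Since distinct constraints are disjoint, such an array also colours the
graph.

Rigidity: a collision with differences `k, l` gives `‖s‖ = sin (π |k| / M) / sin (π |l| / M)`, with
absolute values of minimal representatives. Products of two such sines agree only trivially
(`sine_product_eq`), because the cosines they expand into are independent over the integers. So if
`‖s‖ ≠ 1`, all nontrivial collisions have differences `±k, ±l`; after a shift of the rows they form
the two translation families in `Compatible`, the second one involving `h = 2 ^ (n - 1)` because `ω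
^ h = -1`.

Construction: the difference table `a - b` is Latin, and a few diagonals can be refilled among
themselves (`exists_isLatin_of_diagonals`). Binary digits of the column say which symbol to use.
Equal 2-adic valuations of `k` and `l` need two swapped pairs of diagonals; unequal ones need groups
of four (`exists_compatible_of_lt`), except when one difference is `h` and the other has order four,
where an explicit square of order eight is used.

If `‖s‖ = 1`, then `s` is a power of `ω`, and bitwise addition after a shift of the columns works.
-/

namespace TwoWayRelay

/-! ### Latin squares built from diagonals -/

/-- No symbol repeats in a column or in a row of the array `f`. -/
def IsLatin {α β γ : Type*} (f : α → β → γ) : Prop :=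
  (∀ b, Function.Injective fun a => f a b) ∧ ∀ a, Function.Injective (f a)

/-- The cells of the diagonals `δ i` of the difference table of a group are refilled, among
themselves, according to `G`; the other diagonals stay constant. -/
theorem exists_isLatin_of_diagonals {A ι : Type*} [AddCommGroup A] (δ : ι → A)
    (hδ : Function.Injective δ) (G : ι → A → ι) (hcol : ∀ b, Function.Injective fun i => G i b)
    (hrow : ∀ a, Function.Injective fun i => G i (a - δ i)) :
    ∃ f : A → A → A, IsLatin f ∧ ∀ i a b, a - b = δ i → f a b = δ (G i b) := by
  classical
  let g : A → A → A := fun d b => Function.extend δ (fun i => δ (G i b)) id d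
  have g_apply : ∀ i b, g (δ i) b = δ (G i b) := fun i b => hδ.extend_apply _ _ _
  have g_of_notMem : ∀ d b, (¬ ∃ i, δ i = d) → g d b = d := fun d b h =>
    Function.extend_apply' _ _ _ h
  -- Refilled diagonals use only symbols in the range of `δ`, and the others only symbols outside
  -- it, so a clash can occur only between two refilled diagonals.
  have g_inj : ∀ d d' b b', g d b = g d' b' →
      (∀ i j, d = δ i → d' = δ j → G i b = G j b' → i = j) → d = d' := by
    intro d d' b b' h hij
    by_cases hd : ∃ i, δ i = d <;> by_cases hd' : ∃ i, δ i = d'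
    · obtain ⟨i, rfl⟩ := hd
      obtain ⟨j, rfl⟩ := hd'
      rw [g_apply, g_apply] at h
      rw [hij i j rfl rfl (hδ h)]
    · obtain ⟨i, rfl⟩ := hd
      rw [g_apply, g_of_notMem _ _ hd'] at h
      exact absurd ⟨_, h⟩ hd'
    · obtain ⟨j, rfl⟩ := hd'
      rw [g_apply, g_of_notMem _ _ hd] at h
      exact absurd ⟨_, h.symm⟩ hd
    · rwa [g_of_notMem _ _ hd, g_of_notMem _ _ hd'] at h
  refine ⟨fun a b => g (a - b) b, ⟨fun b a a' h => ?_, fun a b b' h => ?_⟩, ?_⟩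
  · have := g_inj _ _ _ _ h fun i j _ _ hG => hcol b hG
    exact sub_left_injective this
  · have := g_inj _ _ _ _ h fun i j hi hj hG => hrow a (by
      simp only [← hi, ← hj, sub_sub_cancel, hG])
    exact sub_right_injective this
  · intro i a b h
    simp only [h, g_apply]

/-- The binary digits of weight `2 ^ i, …, 2 ^ (i + r - 1)` of a residue modulo `2 ^ n`. -/
theorem exists_digits (n i r : ℕ) (h : i + r ≤ n) :
    ∃ χ : ZMod (2 ^ n) → ZMod (2 ^ r), ∀ (b : ZMod (2 ^ n)) (y : ℤ),
      χ (b + ((2 ^ i * y : ℤ) : ZMod (2 ^ n))) = χ b + y := by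
  refine ⟨fun b => (((b.val : ℤ) / 2 ^ i : ℤ) : ZMod (2 ^ r)), fun b y => ?_⟩
  have hb : (((b + ((2 ^ i * y : ℤ) : ZMod (2 ^ n))).val : ℤ) : ZMod (2 ^ n))
      = ((b.val + 2 ^ i * y : ℤ) : ZMod (2 ^ n)) := by
    push_cast
    simp only [ZMod.natCast_val, ZMod.cast_id', id]
  rw [ZMod.intCast_eq_intCast_iff_dvd_sub] at hb
  obtain ⟨z, hz⟩ := hb
  obtain ⟨c, rfl⟩ := Nat.exists_eq_add_of_le h
  -- Reduction modulo `2 ^ n` subtracts a multiple of `2 ^ n`; divided by `2 ^ i`, it is still a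
  -- multiple of `2 ^ r`, since `i + r ≤ n`.
  have hz' : ((b + ((2 ^ i * y : ℤ) : ZMod (2 ^ (i + r + c)))).val : ℤ)
      = b.val + 2 ^ i * (y - 2 ^ r * (2 ^ c * z)) := by
    have h2 : ((2 ^ (i + r + c) : ℕ) : ℤ) = 2 ^ i * 2 ^ r * 2 ^ c := by
      push_cast; ring
    linear_combination -hz - z * h2
  simp only
  rw [hz', Int.add_mul_ediv_left _ _ (by positivity)]
  have : ((2 ^ r : ℤ) : ZMod (2 ^ r)) = 0 := by
    exact_mod_cast ZMod.natCast_self (2 ^ r)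
  push_cast at this ⊢
  rw [this]
  ring

/-- A nonzero residue modulo `2 ^ n` is an odd multiple of a power of two. -/
theorem exists_two_pow_mul_odd (n : ℕ) (k : ZMod (2 ^ n)) (hk : k ≠ 0) :
    ∃ i < n, ∃ y : ℤ, Odd y ∧ k = ((2 ^ i * y : ℤ) : ZMod (2 ^ n)) := by
  have hv : k.val ≠ 0 := by rwa [Ne, ZMod.val_eq_zero]
  obtain ⟨i, m, hm, h⟩ := Nat.exists_eq_two_pow_mul_odd hv
  refine ⟨i, ?_, m, by exact_mod_cast hm, ?_⟩
  · have h1 : k.val < 2 ^ n := ZMod.val_lt k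
    have h2 : 2 ^ i ≤ k.val := by
      rw [h]; exact Nat.le_mul_of_pos_right _ hm.pos
    exact (Nat.pow_lt_pow_iff_right (by norm_num)).1 (h2.trans_lt h1)
  · rw [← ZMod.natCast_zmod_val k, h]
    push_cast
    rfl

/-- The array `f` has the same symbol in the cells that collide for a fade state of modulus
different from `1`. -/
def Compatible {A : Type*} [AddCommGroup A] (h k l : A) (f : A → A → A) : Prop :=
  (∀ b, f b b = f (b - k) (b - l)) ∧ ∀ b, f (b + l + h) b = f (b + l + h - k) (b + l)

theorem two_pow_pred_add_self (n : ℕ) (hn : 1 ≤ n) :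
    (2 ^ (n - 1) : ZMod (2 ^ n)) + 2 ^ (n - 1) = 0 := by
  rw [← two_mul, ← pow_succ', Nat.sub_add_cancel hn]
  exact_mod_cast ZMod.natCast_self (2 ^ n)

/-- The binary digit of weight `2 ^ i` of a residue modulo `2 ^ n`. -/
theorem exists_digit (n i : ℕ) (h : i < n) :
    ∃ χ : ZMod (2 ^ n) → Bool,
      (∀ b (y : ℤ), Odd y → χ (b + ((2 ^ i * y : ℤ) : ZMod (2 ^ n))) = !χ b) ∧
      ∀ b (j : ℕ) (y : ℤ), i < j → χ (b + ((2 ^ j * y : ℤ) : ZMod (2 ^ n))) = χ b := by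
  obtain ⟨χ, hχ⟩ := exists_digits n i 1 h
  have key : ∀ x : ZMod (2 ^ 1), decide (x + 1 = 0) = !decide (x = 0) := by decide
  have two : ((2 : ℤ) : ZMod (2 ^ 1)) = 0 := rfl
  refine ⟨fun b => decide (χ b = 0), fun b y hy => ?_, fun b j y hj => ?_⟩
  · obtain ⟨m, rfl⟩ := hy
    simp only
    rw [hχ, ← key, Int.cast_add, Int.cast_mul, two, zero_mul, zero_add, Int.cast_one]
  · obtain ⟨c, rfl⟩ := Nat.exists_eq_add_of_lt hj
    have : (2 ^ (i + c + 1) * y : ℤ) = 2 ^ i * (2 * (2 ^ c * y)) := by ring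
    simp only
    rw [this, hχ, Int.cast_mul, two, zero_mul, add_zero]

theorem two_pow_pred_eq (n : ℕ) : (2 ^ (n - 1) : ZMod (2 ^ n)) =
    ((2 ^ (n - 1) * 1 : ℤ) : ZMod (2 ^ n)) := by
  push_cast; ring

theorem two_pow_mul_odd_ne_zero (n i : ℕ) (h : i < n) {y : ℤ} (hy : Odd y) :
    ((2 ^ i * y : ℤ) : ZMod (2 ^ n)) ≠ 0 := by
  obtain ⟨χ, hχ, -⟩ := exists_digit n i h
  intro e
  have := hχ 0 y hy
  rw [e] at this
  simp at this

/-- An odd multiple of `2 ^ (n - 1)`. -/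
theorem two_pow_pred_mul_odd (n : ℕ) (hn : 1 ≤ n) {y : ℤ} (hy : Odd y) :
    ((2 ^ (n - 1) * y : ℤ) : ZMod (2 ^ n)) = 2 ^ (n - 1) := by
  obtain ⟨m, rfl⟩ := hy
  have := two_pow_pred_add_self n hn
  push_cast
  linear_combination (m : ZMod (2 ^ n)) * this

/-- The case of equal valuations. -/
theorem exists_compatible_of_eq (n i : ℕ) (hi : i < n) (κ μ : ℤ) (hκ : Odd κ) (hμ : Odd μ)
    (k l : ZMod (2 ^ n)) (hk : k = ((2 ^ i * κ : ℤ) : ZMod (2 ^ n)))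
    (hl : l = ((2 ^ i * μ : ℤ) : ZMod (2 ^ n))) (hkl : k ≠ l) (hkl' : k ≠ -l) :
    ∃ f, IsLatin f ∧ Compatible (2 ^ (n - 1)) k l f := by
  have hh := two_pow_pred_add_self n (by omega)
  -- In the top valuation both `k` and `l` would be `2 ^ (n - 1)`. Below it, adding `2 ^ (n - 1)`
  -- does not change digit `i`.
  have hi' : i + 1 ≠ n := by
    rintro rfl
    have h1 := two_pow_pred_mul_odd (i + 1) (by omega) hκ
    have h2 := two_pow_pred_mul_odd (i + 1) (by omega) hμ
    simp only [Nat.add_sub_cancel] at h1 h2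
    exact hkl (by rw [hk, hl, h1, h2])
  obtain ⟨χ, hχ, hχ'⟩ := exists_digit n i hi
  have hχk : ∀ b, χ (b + k) = !χ b := fun b => hk ▸ hχ b κ hκ
  have hχl : ∀ b, χ (b + l) = !χ b := fun b => hl ▸ hχ b μ hμ
  have hχh : ∀ b, χ (b + 2 ^ (n - 1)) = χ b := fun b => by
    rw [two_pow_pred_eq]
    exact hχ' b (n - 1) 1 (by omega)
  generalize (2 ^ (n - 1) : ZMod (2 ^ n)) = h at *
  have hkh : k ≠ h := by
    intro e
    have := hχk 0
    rw [e, hχh] at this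
    simp at this
  have hlh : l ≠ h := by
    intro e
    have := hχl 0
    rw [e, hχh] at this
    simp at this
  have e₁ : ∀ a, χ (a - (l - k)) = χ a := fun a => by
    have h₁ := hχl (a - (l - k))
    rw [show a - (l - k) + l = a + k by ring, hχk] at h₁
    simpa using h₁.symm
  have e₂ : ∀ a, χ (a - (h - k)) = !χ a := fun a => by
    have h₁ := hχh (a - (h - k))
    rw [show a - (h - k) + h = a + k by ring, hχk] at h₁
    exact h₁.symm
  have e₃ : ∀ a, χ (a - (l + h)) = !χ a := fun a => by
    have h₁ := hχl (a - (l + h))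
    have h₂ := hχh (a - (l + h) + l)
    rw [h₁, show a - (l + h) + l + h = a by ring] at h₂
    simp [h₂]
  have e₄ : ∀ b, χ (b - l) = !χ b := fun b => by
    have h₁ := hχl (b - l)
    rw [sub_add_cancel] at h₁
    simp [h₁]
  -- The first Boolean selects the collision family, the second one the two diagonals that it links.
  -- Digit `i` of the column decides whether these two exchange symbols.
  let δ : Bool × Bool → ZMod (2 ^ n)
    | (false, false) => 0
    | (false, true) => l - k
    | (true, false) => h - k
    | (true, true) => l + h
  obtain ⟨f, hf, hfδ⟩ := exists_isLatin_of_diagonals δ (by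
      rintro ⟨_ | _, _ | _⟩ ⟨_ | _, _ | _⟩ e <;> simp only [δ] at e ⊢ <;> grind)
    (fun i b => (i.1, xor i.2 (χ b))) (by
      rintro b ⟨g, y⟩ ⟨g', y'⟩ e
      simpa using e) (by
      rintro a ⟨_ | _, _ | _⟩ ⟨_ | _, _ | _⟩ e <;> simp [δ, e₁, e₂, e₃] at e ⊢)
  refine ⟨f, hf, fun b => ?_, fun b => ?_⟩
  · rw [hfδ (false, false) b b (by simp [δ]),
      hfδ (false, true) (b - k) (b - l) (by simp only [δ]; ring)]
    simp [e₄]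
  · rw [hfδ (true, true) (b + l + h) b (by simp only [δ]; ring),
      hfδ (true, false) (b + l + h - k) (b + l) (by simp only [δ]; ring)]
    simp [hχl]

/-- Transposition exchanges `k` and `l`, so only one order of their valuations has to be treated. -/
theorem Compatible.swap {A : Type*} [AddCommGroup A] {h k l : A} (hh : h + h = 0) {f : A → A → A}
    (hf : Compatible h k l f) : Compatible h l k fun a b => f b a := by
  refine ⟨hf.1, fun b => ?_⟩
  have := hf.2 (b + k + h - l)
  rw [show b + k + h - l + l + h = b + k by
      rw [sub_add_cancel, add_assoc, hh, add_zero], add_sub_cancel_right, sub_add_cancel] at this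
  exact this.symm

/-! ### Four diagonals filled with four symbols -/

section Gadget

variable {A : Type*} [CommRing A]

/-- Four diagonals of a difference table. -/
def gadgetDiagonal (k l x : A) : Bool × Bool → A
  | (false, false) => 0
  | (true, false) => l - k
  | (true, true) => -k
  | (false, true) => x - k - l

/-- The symbols on the four diagonals, in the column `b`. -/
def gadgetSymbol (p χ : A → Bool) (l : A) (i : Bool × Bool) (b : A) : Bool × Bool :=
  (xor (p b) i.1, xor i.2 (χ (if i.1 then b + l else b)))

theorem gadgetSymbol_injective (p χ : A → Bool) (l b : A) :
    Function.Injective fun i => gadgetSymbol p χ l i b := by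
  rintro ⟨_ | _, _ | _⟩ ⟨_ | _, _ | _⟩ e <;> simp [gadgetSymbol] at e ⊢

/-- Along a row, `p` flips exactly on the diagonals `l - k` and `x - k - l`. Hence the first symbol
component separates `{0, l - k}` from `{-k, x - k - l}`, and within each pair `χ` separates the two
cells, because `k` and `x` flip it. -/
theorem gadgetSymbol_row_injective (p χ : A → Bool) (k l x : A) (hpl : ∀ b, p (b + l) = !p b)
    (hpk : ∀ b, p (b + k) = p b) (hpx : ∀ b, p (b + x) = p b) (hχk : ∀ b, χ (b + k) = !χ b)
    (hχx : ∀ b, χ (b + x) = !χ b) (a : A) :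
    Function.Injective fun i => gadgetSymbol p χ l i (a - gadgetDiagonal k l x i) := by
  have p₁ : p (a - (l - k)) = !p a := by
    have := hpl (a - (l - k))
    rw [show a - (l - k) + l = a + k by abel, hpk] at this
    simp [this]
  have p₂ : p (a + k) = p a := hpk a
  have p₃ : p (a - (x - k - l)) = !p a := by
    have := hpx (a - (x - k - l))
    rw [show a - (x - k - l) + x = a + l + k by abel, hpk, hpl] at this
    exact this.symm
  have c₁ : χ (a - (l - k) + l) = !χ a := by
    rw [show a - (l - k) + l = a + k by abel, hχk]
  have c₂ : χ (a + k + l) = !χ (a + l) := by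
    rw [show a + k + l = a + l + k by abel, hχk]
  have c₃ : χ (a - (x - k - l)) = χ (a + l) := by
    have := hχx (a - (x - k - l))
    rw [show a - (x - k - l) + x = a + l + k by abel, hχk] at this
    simpa using this.symm
  rintro ⟨_ | _, _ | _⟩ ⟨_ | _, _ | _⟩ e <;>
    simp [gadgetSymbol, gadgetDiagonal, p₁, p₂, p₃, c₁, c₂, c₃] at e ⊢

/-- Diagonals with different values of `p` are distinct, so only those of the same parity remain to
be compared. -/
theorem gadgetDiagonal_digit (p : A → Bool) (k l x : A) (hpl : ∀ b, p (b + l) = !p b)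
    (hpk : ∀ b, p (b + k) = p b) (hpx : ∀ b, p (b + x) = p b) (t : A) (i : Bool × Bool) :
    p (t + gadgetDiagonal k l x i) = xor (p t) (xor i.1 i.2) := by
  have h₁ : p (t + (l - k)) = !p t := by
    rw [← hpk, show t + (l - k) + k = t + l by abel, hpl]
  have h₂ : p (t + -k) = p t := by
    rw [← hpk, neg_add_cancel_right]
  have h₃ : p (t + (x - k - l)) = !p t := by
    have := hpl (t + (x - k - l))
    rw [← hpk, show t + (x - k - l) + l + k = t + x by abel, hpx] at this
    simp [this]
  rcases i with ⟨_ | _, _ | _⟩ <;> simp [gadgetDiagonal, h₁, h₂, h₃]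

/-- Two disjoint groups of four diagonals. -/
theorem exists_compatible_of_two_gadgets (p χ : A → Bool) (h k l x : A) (hh : h + h = 0)
    (hpl : ∀ b, p (b + l) = !p b) (hpk : ∀ b, p (b + k) = p b) (hpx : ∀ b, p (b + x) = p b)
    (hph : ∀ b, p (b + h) = p b) (hχk : ∀ b, χ (b + k) = !χ b) (hχx : ∀ b, χ (b + x) = !χ b)
    (hk : k ≠ 0) (hh₀ : h ≠ 0) (hkh : k ≠ h) (hx : x ≠ l + l) (hx₁ : x ≠ l + l + k + h)
    (hx₂ : x ≠ l + l - k + h) :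
    ∃ f, IsLatin f ∧ Compatible h k l f := by
  have hpk' : ∀ b, p (b + -k) = p b := fun b => by rw [← hpk, neg_add_cancel_right]
  have hχk' : ∀ b, χ (b + -k) = !χ b := fun b => by
    have := hχk (b + -k)
    rw [neg_add_cancel_right] at this
    simp [this]
  -- The second group serves the second collision family: it is the first one with `-k` for `k`,
  -- translated by `h - k`, so that it contains `h - k` and `l + h`.
  let δ : Bool × Bool × Bool → A
    | (false, i) => 0 + gadgetDiagonal k l x i
    | (true, i) => h - k + gadgetDiagonal (-k) l x i
  have hpδ : ∀ i, p (δ i) = xor (p 0) (xor i.2.1 i.2.2) := by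
    rintro ⟨_ | _, i⟩
    · exact gadgetDiagonal_digit p k l x hpl hpk hpx 0 i
    · have h₀ : p (h - k) = p 0 := by
        rw [← hpk, sub_add_cancel, ← zero_add h, hph]
      rw [← h₀]
      exact gadgetDiagonal_digit p (-k) l x hpl hpk' hpx (h - k) i
  have hneg : -h = h := neg_eq_of_add_eq_zero_left hh
  have hδ : Function.Injective δ := by
    intro i j e
    have e' := congrArg p e
    rw [hpδ, hpδ] at e'
    revert e e'
    clear hpδ hpl hpk hpx hph hχk hχx hpk' hχk'
    rcases i with ⟨_ | _, _ | _, _ | _⟩ <;> rcases j with ⟨_ | _, _ | _, _ | _⟩ <;>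
      simp [δ, gadgetDiagonal] <;> grind
  obtain ⟨f, hf, hfδ⟩ := exists_isLatin_of_diagonals δ hδ
    (fun i b => (i.1, gadgetSymbol p χ l i.2 b)) (by
      rintro b ⟨g, i⟩ ⟨g', i'⟩ e
      simp only [Prod.mk.injEq] at e ⊢
      exact ⟨e.1, gadgetSymbol_injective p χ l b e.2⟩) (by
      rintro a ⟨g, i⟩ ⟨g', i'⟩ e
      simp only [Prod.mk.injEq] at e ⊢
      obtain ⟨rfl, e⟩ := e
      refine ⟨rfl, ?_⟩
      rcases g with _ | _
      · exact gadgetSymbol_row_injective p χ k l x hpl hpk hpx hχk hχx a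
          (by simpa [δ] using e)
      · exact gadgetSymbol_row_injective p χ (-k) l x hpl hpk' hpx hχk' hχx (a - (h - k))
          (by simpa only [δ, sub_sub] using e))
  have hpl' : ∀ b, p (b - l) = !p b := fun b => by
    have := hpl (b - l)
    rw [sub_add_cancel] at this
    simp [this]
  refine ⟨f, hf, fun b => ?_, fun b => ?_⟩
  · rw [hfδ (false, false, false) b b (by simp [δ, gadgetDiagonal]),
      hfδ (false, true, false) (b - k) (b - l) (by simp only [δ, gadgetDiagonal]; abel)]
    simp [gadgetSymbol, hpl']
  · rw [hfδ (true, true, false) (b + l + h) b (by simp only [δ, gadgetDiagonal]; abel),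
      hfδ (true, false, false) (b + l + h - k) (b + l) (by simp only [δ, gadgetDiagonal]; abel)]
    simp [gadgetSymbol, hpl]

/-- If `k` has order two, one group of four diagonals is enough. -/
theorem exists_compatible_of_gadget (p χ : A → Bool) (k l : A) (hk2 : k + k = 0)
    (hpl : ∀ b, p (b + l) = !p b) (hpk : ∀ b, p (b + k) = p b) (hχk : ∀ b, χ (b + k) = !χ b)
    (hk : k ≠ 0) (hkl : k ≠ l + l) :
    ∃ f, IsLatin f ∧ Compatible k k l f := by
  have hδ : Function.Injective (gadgetDiagonal k l k) := by
    intro i j e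
    have e' := congrArg (fun d => p (0 + d)) e
    simp only [gadgetDiagonal_digit p k l k hpl hpk hpk] at e'
    revert e e'
    clear hpl hpk hχk
    rcases i with ⟨_ | _, _ | _⟩ <;> rcases j with ⟨_ | _, _ | _⟩ <;>
      simp [gadgetDiagonal] <;> grind
  obtain ⟨f, hf, hfδ⟩ := exists_isLatin_of_diagonals (gadgetDiagonal k l k) hδ
    (gadgetSymbol p χ l) (gadgetSymbol_injective p χ l)
    (gadgetSymbol_row_injective p χ k l k hpl hpk hpk hχk hχk)
  have h₁ : ∀ b, f b b = f (b - k) (b - l) := fun b => by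
    have hpl' : p (b - l) = !p b := by
      have := hpl (b - l)
      rw [sub_add_cancel] at this
      simp [this]
    rw [hfδ (false, false) b b (by simp [gadgetDiagonal]),
      hfδ (true, false) (b - k) (b - l) (by simp only [gadgetDiagonal]; abel)]
    simp [gadgetSymbol, hpl']
  refine ⟨f, hf, h₁, fun b => ?_⟩
  -- Since `-k = k`, the second family of collisions is the first one again, at `b + l`.
  have := h₁ (b + l)
  rw [add_sub_cancel_right, sub_eq_add_neg, neg_eq_of_add_eq_zero_left hk2] at this
  rw [add_sub_cancel_right, this]

end Gadget

/-! ### The exceptional case -/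

/-- A Latin square of order eight in which the cells `(b, b)` and `(b + 4, b - 2)` agree. -/
def latinEight : ZMod 8 → ZMod 8 → ZMod 8 :=
  ![![0, 1, 2, 3, 4, 5, 6, 7],
    ![6, 2, 7, 1, 0, 3, 4, 5],
    ![3, 6, 4, 2, 1, 7, 5, 0],
    ![2, 0, 1, 5, 3, 6, 7, 4],
    ![5, 3, 6, 7, 2, 4, 0, 1],
    ![7, 4, 0, 6, 5, 1, 3, 2],
    ![4, 7, 5, 0, 6, 2, 1, 3],
    ![1, 5, 3, 4, 7, 0, 2, 6]]

set_option maxRecDepth 10000 in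
theorem latinEight_isLatin : IsLatin latinEight := by
  constructor
  · have : ∀ b a a', latinEight a b = latinEight a' b → a = a' := by decide
    exact fun b a a' => this b a a'
  · have : ∀ a b b', latinEight a b = latinEight a b' → b = b' := by decide
    exact fun a b b' => this a b b'

theorem latinEight_diagonal : ∀ b, latinEight b b = latinEight (b + 4) (b - 2) := by
  decide

/-- Twice an odd number is 2 or 6 modulo 8; negating both indices turns one case into the other and
preserves the row shift 4. -/
theorem exists_latin_eight (c : ZMod 8) (hc : c = 2 ∨ c = 6) :
    ∃ T : ZMod 8 → ZMod 8 → ZMod 8, IsLatin T ∧ ∀ b, T b b = T (b + 4) (b - c) := by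
  rcases hc with rfl | rfl
  · exact ⟨latinEight, latinEight_isLatin, latinEight_diagonal⟩
  · refine ⟨fun a b => latinEight (-a) (-b), ⟨fun b => ?_, fun a => ?_⟩, fun b => ?_⟩
    · exact (latinEight_isLatin.1 (-b)).comp neg_injective
    · exact (latinEight_isLatin.2 (-a)).comp neg_injective
    · have := latinEight_diagonal (-b)
      rw [show -b + 4 = -(b + 4) by
          rw [neg_add]; rfl, show -b - 2 = -(b - 6) by
          rw [neg_sub, sub_eq_neg_add, sub_eq_neg_add]
          rw [add_comm]; rfl] at this
      exact this

/-- Here `k` has order two and `l` has order four. -/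
theorem exists_compatible_of_order_four (n : ℕ) (hn : 3 ≤ n) (μ : ℤ) (hμ : Odd μ)
    (l : ZMod (2 ^ n)) (hl : l = ((2 ^ (n - 2) * μ : ℤ) : ZMod (2 ^ n))) :
    ∃ f, IsLatin f ∧ Compatible (2 ^ (n - 1)) (2 ^ (n - 1)) l f := by
  obtain ⟨m, rfl⟩ : ∃ m, n = m + 3 := ⟨n - 3, by omega⟩
  obtain ⟨χ, hχ⟩ := exists_digits (m + 3) m 3 le_rfl
  change ZMod (2 ^ (m + 3)) → ZMod 8 at χ
  replace hχ : ∀ b (y : ℤ), χ (b + ((2 ^ m * y : ℤ) : ZMod (2 ^ (m + 3)))) = χ b + y := hχ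
  have hc : ((2 * μ : ℤ) : ZMod 8) = 2 ∨ ((2 * μ : ℤ) : ZMod 8) = 6 := by
    obtain ⟨v, rfl⟩ := hμ
    push_cast
    generalize (v : ZMod 8) = v
    revert v
    decide
  obtain ⟨T, hT, hTc⟩ := exists_latin_eight _ hc
  -- The eight refilled diagonals form the subgroup generated by `2 ^ m`, and `χ` is a coordinate
  -- along its cosets. Each block of cells on one coset receives a copy of `T`.
  let δ : ZMod 8 → ZMod (2 ^ (m + 3)) := fun c =>
    ((2 ^ m * (c.val : ℤ) : ℤ) : ZMod (2 ^ (m + 3)))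
  have cast_val : ∀ c : ZMod 8, (((c.val : ℕ) : ℤ) : ZMod 8) = c := fun c => by
    rw [Int.cast_natCast, ZMod.natCast_zmod_val]
  have hχδ : ∀ b c, χ (b + δ c) = χ b + c := fun b c => by
    rw [hχ, cast_val]
  have hχδ' : ∀ b c, χ (b - δ c) = χ b - c := fun b c => by
    rw [eq_sub_iff_add_eq, ← hχδ, sub_add_cancel]
  obtain ⟨f, hf, hfδ⟩ := exists_isLatin_of_diagonals δ (fun c c' e => by
      have := congrArg (fun d => χ (0 + d)) e
      simpa only [hχδ, add_right_inj] using this)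
    (fun c b => T (χ b + c) (χ b)) (fun b c c' e => by
      simpa using hT.1 _ e) (fun a c c' e => by
      simp only [hχδ', sub_add_cancel] at e
      simpa using hT.2 _ e)
  have hh := two_pow_pred_add_self (m + 3) (by omega)
  have hh' : (2 ^ (m + 3 - 1) : ZMod (2 ^ (m + 3))) = ((2 ^ m * 4 : ℤ) : ZMod (2 ^ (m + 3))) := by
    rw [show m + 3 - 1 = m + 2 by omega]
    push_cast; ring
  have hl' : l = ((2 ^ m * (2 * μ) : ℤ) : ZMod (2 ^ (m + 3))) := by
    rw [hl, show m + 3 - 2 = m + 1 by omega]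
    push_cast; ring
  have eight : ∀ y : ℤ, ((2 ^ m * (8 * y) : ℤ) : ZMod (2 ^ (m + 3))) = 0 := fun y => by
    have h8 : (((2 ^ (m + 3) : ℕ) : ℤ) : ZMod (2 ^ (m + 3))) = 0 := by
      rw [Int.cast_natCast, ZMod.natCast_self]
    have : (2 ^ m * (8 * y) : ℤ) = ((2 ^ (m + 3) : ℕ) : ℤ) * y := by
      push_cast; ring
    rw [this, Int.cast_mul, h8, zero_mul]
  have hδ_cast : ∀ y : ℤ, δ (y : ZMod 8) = ((2 ^ m * y : ℤ) : ZMod (2 ^ (m + 3))) := fun y => by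
    have h1 : ((((y : ZMod 8).val : ℕ) : ℤ) : ZMod 8) = y := cast_val _
    rw [ZMod.intCast_eq_intCast_iff_dvd_sub] at h1
    obtain ⟨z, hz⟩ := h1
    have h2 := eight z
    rw [show (8 * z : ℤ) = ((8 : ℕ) : ℤ) * z by norm_num, ← hz, mul_sub, Int.cast_sub,
      sub_eq_zero] at h2
    exact h2.symm
  generalize (2 ^ (m + 3 - 1) : ZMod (2 ^ (m + 3))) = h at *
  have h₁ : ∀ b, f b b = f (b - h) (b - l) := fun b => by
    have hχl : χ (b - l) = χ b - ((2 * μ : ℤ) : ZMod 8) := by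
      rw [hl', ← hδ_cast, hχδ']
    rw [hfδ ((0 : ℤ) : ZMod 8) b b (by rw [hδ_cast]; simp),
      hfδ ((2 * μ - 4 : ℤ) : ZMod 8) (b - h) (b - l) (by
        rw [hδ_cast, mul_sub, Int.cast_sub, ← hl', ← hh']; ring)]
    have e1 : χ b - ((2 * μ : ℤ) : ZMod 8) + ((2 * μ - 4 : ℤ) : ZMod 8) = χ b + 4 := by
      rw [Int.cast_sub, sub_add_sub_cancel, sub_eq_add_neg]
      rfl
    simp only [hχl]
    rw [e1, Int.cast_zero, add_zero, hTc]
  refine ⟨f, hf, h₁, fun b => ?_⟩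
  have := h₁ (b + l)
  rw [add_sub_cancel_right, sub_eq_add_neg, neg_eq_of_add_eq_zero_left hh] at this
  rw [add_sub_cancel_right, this]

/-! ### Latin squares compatible with given differences -/

theorem exists_compatible_of_lt (n : ℕ) (hn : 3 ≤ n) (i j : ℕ) (hi : i < n) (hji : j < i)
    (κ μ : ℤ) (hκ : Odd κ) (hμ : Odd μ) (k l : ZMod (2 ^ n))
    (hk : k = ((2 ^ i * κ : ℤ) : ZMod (2 ^ n))) (hl : l = ((2 ^ j * μ : ℤ) : ZMod (2 ^ n))) :
    ∃ f, IsLatin f ∧ Compatible (2 ^ (n - 1)) k l f := by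
  have hh := two_pow_pred_add_self n (by omega)
  have hh₀ : (2 ^ (n - 1) : ZMod (2 ^ n)) ≠ 0 := by
    rw [two_pow_pred_eq]
    exact two_pow_mul_odd_ne_zero n (n - 1) (by omega) odd_one
  have hk₀ : k ≠ 0 := hk ▸ two_pow_mul_odd_ne_zero n i hi hκ
  have h2l : l + l = ((2 ^ (j + 1) * μ : ℤ) : ZMod (2 ^ n)) := by
    rw [hl]; push_cast; ring
  obtain ⟨p, hp, hp'⟩ := exists_digit n j (by omega)
  obtain ⟨χ, hχ, hχ'⟩ := exists_digit n i hi
  obtain ⟨q, hq, hq'⟩ := exists_digit n (j + 1) (by omega)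
  have hpl : ∀ b, p (b + l) = !p b := fun b => hl ▸ hp b μ hμ
  have hpk : ∀ b, p (b + k) = p b := fun b => hk ▸ hp' b i κ hji
  have hχk : ∀ b, χ (b + k) = !χ b := fun b => hk ▸ hχ b κ hκ
  have hql : ∀ b, q (b + (l + l)) = !q b := fun b => h2l ▸ hq b μ hμ
  have hph : ∀ b, p (b + 2 ^ (n - 1)) = p b := fun b => by
    rw [two_pow_pred_eq]; exact hp' b (n - 1) 1 (by omega)
  rcases Nat.lt_or_ge (i + 1) n with hin | hin
  · have hkh : k ≠ 2 ^ (n - 1) := by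
      intro e
      have h1 := hχk 0
      rw [e, two_pow_pred_eq, hχ' 0 (n - 1) 1 (by omega)] at h1
      simp at h1
    rcases Nat.lt_or_ge (j + 1) i with hij | hij
    · have hqk : ∀ b, q (b + k) = q b := fun b => hk ▸ hq' b i κ hij
      have hqh : ∀ b, q (b + 2 ^ (n - 1)) = q b := fun b => by
        rw [two_pow_pred_eq]; exact hq' b (n - 1) 1 (by omega)
      refine exists_compatible_of_two_gadgets p χ _ k l k hh hpl hpk hpk hph hχk hχk hk₀ hh₀ hkh
        ?_ ?_ ?_
      · intro e
        have h1 := hql 0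
        rw [← e, hqk] at h1
        simp at h1
      · intro e
        have h1 := hql 0
        rw [← hqk, ← hqh, add_assoc, add_assoc, add_comm (0 : ZMod (2 ^ n)), ← add_assoc, ← e,
          add_zero, ← zero_add k, hqk] at h1
        simp at h1
      · intro e
        have h1 := hqk k
        have h2 : k + k = 0 + (l + l) + 2 ^ (n - 1) := by
          nth_rw 1 [e]; ring
        rw [h2, hqh, hql, ← zero_add k, hqk] at h1
        simp at h1
    -- Now `k` and `l + l` have the same valuation and may coincide. The choice `x = l + l + h`
    -- flips the same digit `i` and differs from `l + l`.
    · obtain rfl : i = j + 1 := by omega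
      have hpx : ∀ b, p (b + (l + l + 2 ^ (n - 1))) = p b := fun b => by
        rw [← add_assoc, hph, h2l, hp' b (j + 1) μ (by omega)]
      have hχx : ∀ b, χ (b + (l + l + 2 ^ (n - 1))) = !χ b := fun b => by
        rw [← add_assoc, two_pow_pred_eq, hχ' _ (n - 1) 1 (by omega), h2l, hχ b μ hμ]
      refine exists_compatible_of_two_gadgets p χ _ k l (l + l + 2 ^ (n - 1)) hh hpl hpk hpx hph
        hχk hχx hk₀ hh₀ hkh ?_ ?_ ?_
      · simpa using hh₀
      · simpa using hk₀
      · exact fun e => hk₀ (by linear_combination e)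
  · obtain rfl : i = n - 1 := by omega
    obtain rfl : k = 2 ^ (n - 1) := by
      rw [hk, two_pow_pred_mul_odd n (by omega) hκ]
    rcases Nat.lt_or_ge (j + 1) (n - 1) with hij | hij
    · refine exists_compatible_of_gadget p χ _ l hh hpl hpk hχk hk₀ ?_
      intro e
      have h1 := hql 0
      rw [← e, two_pow_pred_eq, hq' 0 (n - 1) 1 hij] at h1
      simp at h1
    -- Here `l + l = k`, so with `x = k` the diagonals `l - k` and `x - k - l` would coincide.
    · obtain rfl : j = n - 2 := by omega
      exact exists_compatible_of_order_four n hn μ hμ l hl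

theorem exists_compatible (n : ℕ) (hn : 3 ≤ n) (k l : ZMod (2 ^ n)) (hk : k ≠ 0) (hl : l ≠ 0)
    (hkl : k ≠ l) (hkl' : k ≠ -l) : ∃ f, IsLatin f ∧ Compatible (2 ^ (n - 1)) k l f := by
  obtain ⟨i, hi, κ, hκ, hk'⟩ := exists_two_pow_mul_odd n k hk
  obtain ⟨j, hj, μ, hμ, hl'⟩ := exists_two_pow_mul_odd n l hl
  rcases lt_trichotomy i j with h | rfl | h
  · obtain ⟨f, hf, hfc⟩ := exists_compatible_of_lt n hn j i hj h μ κ hμ hκ l k hl' hk'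
    exact ⟨fun a b => f b a, ⟨hf.2, hf.1⟩, hfc.swap (two_pow_pred_add_self n (by omega))⟩
  · exact exists_compatible_of_eq n i hi κ μ hκ hμ k l hk' hl' hkl hkl'
  · exact exists_compatible_of_lt n hn i j hi h κ μ hκ hμ k l hk' hl'

/-! ### Products of sines -/

open Polynomial in
/-- The numbers `cos (π j / 2 ^ n)`, `j < 2 ^ (n - 1)`, are linearly independent over `ℤ`. -/
theorem cos_linear_independent (n : ℕ) (hn : 1 ≤ n) (c : ℕ → ℤ)
    (h : ∑ j ∈ Finset.range (2 ^ (n - 1)), (c j : ℝ) * Real.cos (Real.pi * j / 2 ^ n) = 0) :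
    ∀ j < 2 ^ (n - 1), c j = 0 := by
  set K := 2 ^ (n - 1) with hK
  have hM : 2 ^ n = 2 * K := by
    rw [hK, ← pow_succ', Nat.sub_add_cancel hn]
  have hMR : (2 ^ n : ℝ) = 2 * K := by exact_mod_cast hM
  have hK0 : 0 < K := by positivity
  let z : ℂ := Complex.exp (2 * Real.pi * Complex.I / (2 ^ (n + 1) : ℕ))
  have hz : IsPrimitiveRoot z (2 ^ (n + 1)) :=
    Complex.isPrimitiveRoot_exp _ (by positivity)
  have hzj : ∀ j : ℕ, z ^ j = Complex.exp ((Real.pi * j / 2 ^ n : ℝ) * Complex.I) := fun j => by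
    rw [← Complex.exp_nat_mul]
    congr 1
    push_cast
    field_simp
    ring
  let P : ℤ[X] := ∑ j ∈ Finset.range K, C (c j) * (X ^ (K + j) + X ^ (K - j))
  -- Multiplying the relation by `2 z ^ K` clears the negative powers of `z`. The result has degree
  -- below `2 K`, the degree of the minimal polynomial of `z`.
  have hPz : aeval z P = 0 := by
    have hterm : ∀ j ∈ Finset.range K, aeval z (C (c j) * (X ^ (K + j) + X ^ (K - j)))
        = 2 * z ^ K * ((c j : ℝ) * Real.cos (Real.pi * j / 2 ^ n) : ℝ) := fun j hj => by
      have hjK : j < K := Finset.mem_range.1 hj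
      have hinv : z ^ (K - j) * z ^ j = z ^ K := by
        rw [← pow_add, Nat.sub_add_cancel hjK.le]
      have hcos : (Real.cos (Real.pi * j / 2 ^ n) : ℂ) * 2 = z ^ j + (z ^ j)⁻¹ := by
        rw [hzj, ← Complex.exp_neg, Complex.ofReal_cos, Complex.cos]
        rw [neg_mul]
        ring
      have hz0 : z ^ j ≠ 0 := pow_ne_zero _ (Complex.exp_ne_zero _)
      have h1 : z ^ (K - j) = z ^ K * (z ^ j)⁻¹ := by
        rw [← hinv]; field_simp
      simp only [map_mul, map_add, map_pow, aeval_X, aeval_C, Complex.ofReal_mul]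
      rw [h1, pow_add]
      simp only [algebraMap_int_eq, eq_intCast, Complex.ofReal_intCast]
      linear_combination -(c j : ℂ) * z ^ K * hcos
    rw [map_sum, Finset.sum_congr rfl hterm, ← Finset.mul_sum, ← Complex.ofReal_sum, h]
    simp
  have hdvd : minpoly ℤ z ∣ P :=
    minpoly.isIntegrallyClosed_dvd (hz.isIntegral (by positivity)) hPz
  have hdeg : P.natDegree < (minpoly ℤ z).natDegree := by
    rw [← cyclotomic_eq_minpoly hz (by positivity), natDegree_cyclotomic,
      Nat.totient_prime_pow_succ Nat.prime_two, show 2 ^ n * (2 - 1) = 2 * K by rw [hM]; simp]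
    refine lt_of_le_of_lt (natDegree_sum_le_of_forall_le (n := 2 * K - 1) _ _ fun j hj => ?_)
      (by omega)
    have hjK : j < K := Finset.mem_range.1 hj
    refine (natDegree_C_mul_le _ _).trans ((natDegree_add_le _ _).trans ?_)
    rw [natDegree_X_pow, natDegree_X_pow]
    omega
  have hP : P = 0 := eq_zero_of_dvd_of_natDegree_lt hdvd hdeg
  intro j hj
  have hcoeff : P.coeff (K + j) = if j = 0 then 2 * c j else c j := by
    simp only [P, finsetSum_coeff, coeff_C_mul, coeff_add, coeff_X_pow]
    rw [Finset.sum_eq_single j]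
    · rcases Nat.eq_zero_or_pos j with rfl | hj0
      · simp; ring
      · rw [if_pos rfl, if_neg (by omega), if_neg (by omega)]; ring
    · intro i _ hij
      rw [if_neg (by omega), if_neg (by omega)]; ring
    · intro hj'
      exact absurd (Finset.mem_range.2 hj) hj'
  rw [hP, coeff_zero] at hcoeff
  split_ifs at hcoeff <;> omega

/-- The coordinates of `2 sin (π x / M) sin (π y / M)` in the basis `cos (π j / M)`. -/
def sineProductCoeff (M x y j : ℕ) : ℤ :=
  (if j = x - y then 1 else 0) - (if j = x + y then 1 else 0)
    + (if j + x + y = M then 1 else 0)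

/-- The product is `cos (x - y) - cos (x + y)` in units of `π / M`. If `x + y` exceeds `K = M / 2`,
reflection in `π / 2` brings the second cosine into the basis with opposite sign; if `x + y = K`, it
vanishes. -/
theorem sum_sineProductCoeff (n : ℕ) (hn : 1 ≤ n) (x y : ℕ) (hy : 1 ≤ y) (hyx : y ≤ x)
    (hx : x ≤ 2 ^ (n - 1)) :
    ∑ j ∈ Finset.range (2 ^ (n - 1)),
        (sineProductCoeff (2 ^ n) x y j : ℝ) * Real.cos (Real.pi * j / 2 ^ n)
      = 2 * (Real.sin (Real.pi * x / 2 ^ n) * Real.sin (Real.pi * y / 2 ^ n)) := by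
  set K := 2 ^ (n - 1) with hK
  have hM : 2 ^ n = 2 * K := by
    rw [hK, ← pow_succ', Nat.sub_add_cancel hn]
  have hMR : (2 ^ n : ℝ) = 2 * K := by exact_mod_cast hM
  have hK0 : 0 < K := by positivity
  have hKR : (K : ℝ) ≠ 0 := by positivity
  have hprod : 2 * (Real.sin (Real.pi * x / 2 ^ n) * Real.sin (Real.pi * y / 2 ^ n))
      = Real.cos (Real.pi * (x - y : ℕ) / 2 ^ n) - Real.cos (Real.pi * (x + y : ℕ) / 2 ^ n) := by
    rw [Nat.cast_sub hyx, Nat.cast_add, mul_sub, mul_add, sub_div, add_div, Real.cos_sub,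
      Real.cos_add]
    ring
  rw [hprod]
  have hsplit : ∀ j, (sineProductCoeff (2 ^ n) x y j : ℝ) * Real.cos (Real.pi * j / 2 ^ n)
      = (if j = x - y then Real.cos (Real.pi * j / 2 ^ n) else 0)
        - (if j = x + y then Real.cos (Real.pi * j / 2 ^ n) else 0)
        + (if j + x + y = 2 ^ n then Real.cos (Real.pi * j / 2 ^ n) else 0) := fun j => by
    simp only [sineProductCoeff]
    push_cast
    simp only [add_mul, sub_mul, ite_mul, one_mul, zero_mul]
  simp only [hsplit, Finset.sum_add_distrib, Finset.sum_sub_distrib]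
  have s₁ : ∑ j ∈ Finset.range K, (if j = x - y then Real.cos (Real.pi * j / 2 ^ n) else 0)
      = Real.cos (Real.pi * (x - y : ℕ) / 2 ^ n) := by
    rw [Finset.sum_ite_eq', if_pos (Finset.mem_range.2 (by omega))]
  have s₂ : ∑ j ∈ Finset.range K, (if j = x + y then Real.cos (Real.pi * j / 2 ^ n) else 0)
      = if x + y < K then Real.cos (Real.pi * (x + y : ℕ) / 2 ^ n) else 0 := by
    rw [Finset.sum_ite_eq']
    simp only [Finset.mem_range]
  have s₃ : ∑ j ∈ Finset.range K,
      (if j + x + y = 2 ^ n then Real.cos (Real.pi * j / 2 ^ n) else 0)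
      = if K < x + y then -Real.cos (Real.pi * (x + y : ℕ) / 2 ^ n) else 0 := by
    have : ∀ j, j + x + y = 2 ^ n ↔ j = 2 * K - (x + y) := fun j => by omega
    simp only [this]
    rw [Finset.sum_ite_eq']
    by_cases h : K < x + y
    · rw [if_pos h, if_pos (Finset.mem_range.2 (by omega)), Nat.cast_sub (by omega),
        ← Real.cos_pi_sub]
      congr 1
      rw [hMR]
      push_cast
      field_simp
    · rw [if_neg h, if_neg (by rw [Finset.mem_range]; omega)]
  rw [s₁, s₂, s₃]
  rcases lt_trichotomy (x + y) K with h | h | h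
  · rw [if_pos h, if_neg (by omega)]; ring
  · rw [if_neg (by omega), if_neg (by omega), h, hMR,
      show Real.pi * (K : ℝ) / (2 * K) = Real.pi / 2 by field_simp, Real.cos_pi_div_two]
    ring
  · rw [if_neg (by omega), if_pos h]; ring

theorem eq_of_sineProductCoeff_eq (K x y x' y' : ℕ) (hy : 1 ≤ y) (hyx : y ≤ x)
    (hx : x ≤ K) (hy' : 1 ≤ y') (hyx' : y' ≤ x') (hx' : x' ≤ K)
    (h : ∀ j < K, sineProductCoeff (2 * K) x y j = sineProductCoeff (2 * K) x' y' j)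
    (hxx' : x ≤ x') : x = x' ∧ y = y' := by
  simp only [sineProductCoeff] at h
  by_cases hd : x - y = x' - y'
  · by_contra hne
    have hlt : x + y < x' + y' := by omega
    rcases Nat.lt_or_ge (x + y) K with hK | hK
    · have h1 := h (x + y) hK
      rw [if_neg (by omega), if_pos rfl, if_neg (by omega), if_neg (by omega),
        if_neg (by omega)] at h1
      split_ifs at h1 <;> omega
    · have h1 := h (2 * K - (x' + y')) (by omega)
      rw [hd, if_neg (by omega : ¬ 2 * K - (x' + y') = x + y),
        if_neg (by omega : ¬ 2 * K - (x' + y') + x + y = 2 * K),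
        if_neg (by omega : ¬ 2 * K - (x' + y') = x' + y'),
        if_pos (by omega : 2 * K - (x' + y') + x' + y' = 2 * K)] at h1
      split_ifs at h1 <;> omega
  -- The coefficient 1 at each difference must come from the reflected term of the other pair. The
  -- two resulting equations force `x = x' = K` and `y = y'`.
  · have h1 := h (x - y) (by omega)
    have h2 := h (x' - y') (by omega)
    rw [if_pos rfl, if_neg (by omega : ¬ x - y = x + y), if_neg hd] at h1
    rw [if_neg (by omega), if_pos rfl, if_neg (by omega : ¬ x' - y' = x' + y')] at h2
    split_ifs at h1 h2 <;> omega

/-- Products of two sines of multiples of `π / 2 ^ n` agree only trivially. -/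
theorem sine_product_eq (n : ℕ) (hn : 1 ≤ n) (x y x' y' : ℕ) (hx1 : 1 ≤ x) (hy1 : 1 ≤ y)
    (hx1' : 1 ≤ x') (hy1' : 1 ≤ y') (hx : x ≤ 2 ^ (n - 1)) (hy : y ≤ 2 ^ (n - 1))
    (hx' : x' ≤ 2 ^ (n - 1)) (hy' : y' ≤ 2 ^ (n - 1))
    (h : Real.sin (Real.pi * x / 2 ^ n) * Real.sin (Real.pi * y / 2 ^ n)
      = Real.sin (Real.pi * x' / 2 ^ n) * Real.sin (Real.pi * y' / 2 ^ n)) :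
    (x = x' ∧ y = y') ∨ (x = y' ∧ y = x') := by
  wlog hyx : y ≤ x generalizing x y
  · have := this y x hy1 hx1 hy hx (by rw [mul_comm, h]) (by omega)
    tauto
  wlog hyx' : y' ≤ x' generalizing x' y'
  · have := this y' x' hy1' hx1' hy' hx' (by rw [h, mul_comm]) (by omega)
    tauto
  have hM : 2 ^ n = 2 * 2 ^ (n - 1) := by
    rw [← pow_succ', Nat.sub_add_cancel hn]
  have hcoeff := cos_linear_independent n hn
    (fun j => sineProductCoeff (2 ^ n) x y j - sineProductCoeff (2 ^ n) x' y' j) (by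
      simp only [Int.cast_sub, sub_mul, Finset.sum_sub_distrib]
      rw [sum_sineProductCoeff n hn x y hy1 hyx hx, sum_sineProductCoeff n hn x' y' hy1' hyx' hx',
        h, sub_self])
  rw [hM] at hcoeff
  rcases le_total x x' with hle | hle
  · exact Or.inl (eq_of_sineProductCoeff_eq _ x y x' y' hy1 hyx hx hy1' hyx' hx'
      (fun j hj => sub_eq_zero.1 (hcoeff j hj)) hle)
  · have := eq_of_sineProductCoeff_eq _ x' y' x y hy1' hyx' hx' hy1 hyx hx
      (fun j hj => (sub_eq_zero.1 (hcoeff j hj)).symm) hle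
    exact Or.inl ⟨this.1.symm, this.2.symm⟩

/-! ### Collisions of the effective constellation -/

section Collisions

variable {n : ℕ}

/-- The symbol `f a b` depends only on the point `ω ^ a + s ω ^ b`, where `ω` is the standard
primitive root of unity of order `2 ^ n`. -/
def Resolves {T : Type*} (s : ℂ) (f : ZMod (2 ^ n) → ZMod (2 ^ n) → T) : Prop :=
  ∀ a b a' b', ZMod.stdAddChar a + s * ZMod.stdAddChar b
    = ZMod.stdAddChar a' + s * ZMod.stdAddChar b' → f a b = f a' b'

theorem norm_stdAddChar (a : ZMod (2 ^ n)) : ‖ZMod.stdAddChar a‖ = 1 :=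
  AddChar.norm_apply _ _

theorem norm_stdAddChar_sub (a b : ZMod (2 ^ n)) :
    ‖ZMod.stdAddChar a - ZMod.stdAddChar b‖
      = 2 * Real.sin (Real.pi * ((a - b).valMinAbs.natAbs : ℕ) / 2 ^ n) := by
  obtain ⟨d, rfl⟩ : ∃ d, a = d + b := ⟨a - b, by ring⟩
  rw [add_sub_cancel_right, AddChar.map_add_eq_mul]
  have h1 : ZMod.stdAddChar d * ZMod.stdAddChar b - ZMod.stdAddChar b
      = (ZMod.stdAddChar d - 1) * ZMod.stdAddChar b := by ring
  rw [h1, norm_mul, norm_stdAddChar, mul_one]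
  have h2 : (ZMod.stdAddChar d : ℂ)
      = Complex.exp (Complex.I * ((2 * (Real.pi * d.valMinAbs / 2 ^ n) : ℝ) : ℂ)) := by
    conv_lhs => rw [← ZMod.coe_valMinAbs d, ZMod.stdAddChar_coe]
    congr 1
    push_cast
    ring
  rw [h2, Complex.norm_exp_I_mul_ofReal_sub_one, mul_div_cancel_left₀ _ two_ne_zero, norm_mul,
    Real.norm_ofNat, Real.norm_eq_abs]
  congr 1
  have hM : (0 : ℝ) < 2 ^ n := by positivity
  have hle : (d.valMinAbs.natAbs : ℝ) ≤ 2 ^ n := by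
    have := (ZMod.natAbs_valMinAbs_le d).trans (Nat.div_le_self _ _)
    exact_mod_cast this
  have hnonneg : 0 ≤ Real.sin (Real.pi * (d.valMinAbs.natAbs : ℕ) / 2 ^ n) := by
    apply Real.sin_nonneg_of_nonneg_of_le_pi
    · positivity
    · rw [div_le_iff₀ hM]
      exact mul_le_mul_of_nonneg_left hle Real.pi_pos.le
  have hcast : (d.valMinAbs : ℝ) = d.valMinAbs.natAbs
      ∨ (d.valMinAbs : ℝ) = -(d.valMinAbs.natAbs : ℝ) := by
    rcases Int.natAbs_eq d.valMinAbs with h | h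
    · left
      conv_lhs => rw [h, Int.cast_natCast]
    · right
      conv_lhs => rw [h, Int.cast_neg, Int.cast_natCast]
  rw [← abs_of_nonneg hnonneg]
  rcases hcast with h | h
  · rw [h]
  · rw [h, mul_neg, neg_div, Real.sin_neg, abs_neg]

theorem valMinAbs_natAbs_bounds (hn : 1 ≤ n) (d : ZMod (2 ^ n)) (hd : d ≠ 0) :
    1 ≤ d.valMinAbs.natAbs ∧ d.valMinAbs.natAbs ≤ 2 ^ (n - 1) := by
  constructor
  · rw [Nat.one_le_iff_ne_zero, Ne, Int.natAbs_eq_zero, ZMod.valMinAbs_eq_zero]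
    exact hd
  · have := ZMod.natAbs_valMinAbs_le d
    rwa [show 2 ^ n / 2 = 2 ^ (n - 1) by
      rw [Nat.pow_div hn (by norm_num)]] at this

/-- Products of two distances between points of the constellation agree only trivially. -/
theorem eq_or_eq_of_norm_mul_eq (hn : 1 ≤ n) {a a' b b' c c' d d' : ZMod (2 ^ n)} (ha : a ≠ a')
    (hb : b ≠ b') (hc : c ≠ c') (hd : d ≠ d')
    (h : ‖ZMod.stdAddChar a - ZMod.stdAddChar a'‖ * ‖ZMod.stdAddChar b - ZMod.stdAddChar b'‖
      = ‖ZMod.stdAddChar c - ZMod.stdAddChar c'‖ * ‖ZMod.stdAddChar d - ZMod.stdAddChar d'‖) :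
    ((a - a' = c - c' ∨ a - a' = -(c - c')) ∧ (b - b' = d - d' ∨ b - b' = -(d - d')))
    ∨ ((a - a' = d - d' ∨ a - a' = -(d - d')) ∧ (b - b' = c - c' ∨ b - b' = -(c - c'))) := by
  have ha := valMinAbs_natAbs_bounds hn _ (sub_ne_zero.2 ha)
  have hb := valMinAbs_natAbs_bounds hn _ (sub_ne_zero.2 hb)
  have hc := valMinAbs_natAbs_bounds hn _ (sub_ne_zero.2 hc)
  have hd := valMinAbs_natAbs_bounds hn _ (sub_ne_zero.2 hd)
  simp only [← ZMod.natAbs_valMinAbs_eq_natAbs_valMinAbs]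
  refine sine_product_eq n hn _ _ _ _ ha.1 hb.1 hc.1 hd.1 ha.2 hb.2 hc.2 hd.2 ?_
  simp only [norm_stdAddChar_sub] at h
  linarith

theorem stdAddChar_half (hn : 1 ≤ n) : ZMod.stdAddChar (2 ^ (n - 1) : ZMod (2 ^ n)) = -1 := by
  have h2 := two_pow_pred_add_self n hn
  have h0 : (2 ^ (n - 1) : ZMod (2 ^ n)) ≠ 0 := by
    rw [two_pow_pred_eq]
    exact two_pow_mul_odd_ne_zero n (n - 1) (by omega) odd_one
  have hsq := congrArg (ZMod.stdAddChar (N := 2 ^ n)) h2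
  rw [AddChar.map_add_eq_mul, AddChar.map_zero_eq_one] at hsq
  rcases mul_self_eq_one_iff.1 hsq with h | h
  · exact absurd (ZMod.injective_stdAddChar (h.trans (AddChar.map_zero_eq_one _).symm)) h0
  · exact h

theorem exists_resolves_of_norm_ne_one (hn : 3 ≤ n) (s : ℂ) (hs : ‖s‖ ≠ 1)
    {a₀ b₀ a₁ b₁ : ZMod (2 ^ n)} (ha : a₀ ≠ a₁) (hb : b₀ ≠ b₁)
    (h₀ : ZMod.stdAddChar a₀ - ZMod.stdAddChar a₁
      = -s * (ZMod.stdAddChar b₀ - ZMod.stdAddChar b₁)) :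
    ∃ f : ZMod (2 ^ n) → ZMod (2 ^ n) → ZMod (2 ^ n), IsLatin f ∧ Resolves s f := by
  have hB : ZMod.stdAddChar b₀ - ZMod.stdAddChar b₁ ≠ 0 := fun h =>
    hb (ZMod.injective_stdAddChar (sub_eq_zero.1 h))
  have hA : ZMod.stdAddChar a₀ - ZMod.stdAddChar a₁ ≠ 0 := fun h =>
    ha (ZMod.injective_stdAddChar (sub_eq_zero.1 h))
  have hs0 : s ≠ 0 := by
    rintro rfl
    exact hA (by simpa using h₀)
  -- Equal differences up to sign give chords of equal length, hence `‖s‖ = 1`.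
  have hkl : ¬ (a₀ - a₁ = b₀ - b₁ ∨ a₀ - a₁ = -(b₀ - b₁)) := by
    rw [← ZMod.natAbs_valMinAbs_eq_natAbs_valMinAbs]
    intro h
    have h1 := norm_stdAddChar_sub a₀ a₁
    rw [h, ← norm_stdAddChar_sub, h₀, norm_mul, norm_neg] at h1
    exact hs (mul_right_cancel₀ (norm_ne_zero_iff.2 hB) (h1.trans (one_mul _).symm))
  obtain ⟨f, hf, hf₁, hf₂⟩ := exists_compatible n hn (a₀ - a₁) (b₀ - b₁) (sub_ne_zero.2 ha)
    (sub_ne_zero.2 hb) (fun h => hkl (Or.inl h)) (fun h => hkl (Or.inr h))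
  have hhalf := stdAddChar_half (n := n) (by omega)
  have hh := two_pow_pred_add_self n (by omega)
  generalize (2 ^ (n - 1) : ZMod (2 ^ n)) = h at *
  -- The row shift moves `(a₀, b₀)` to the main diagonal.
  refine ⟨fun a b => f (a - (a₀ - b₀)) b, ⟨fun b => (hf.1 b).comp sub_left_injective,
    fun a => hf.2 _⟩, ?_⟩
  have key : ∀ a b a' b', ZMod.stdAddChar a + s * ZMod.stdAddChar b
      = ZMod.stdAddChar a' + s * ZMod.stdAddChar b' → a - a' = a₀ - a₁ →
      (b - b' = b₀ - b₁ ∨ b - b' = -(b₀ - b₁)) →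
      f (a - (a₀ - b₀)) b = f (a' - (a₀ - b₀)) b' := by
    intro a b a' b' e hka hlb
    have e' : ZMod.stdAddChar a - ZMod.stdAddChar a'
        = -s * (ZMod.stdAddChar b - ZMod.stdAddChar b') := by linear_combination e
    have hA' : ZMod.stdAddChar a - ZMod.stdAddChar a'
        = ZMod.stdAddChar (a - a₀) * (ZMod.stdAddChar a₀ - ZMod.stdAddChar a₁) := by
      rw [mul_sub, ← AddChar.map_add_eq_mul, ← AddChar.map_add_eq_mul, sub_add_cancel,
        show a - a₀ + a₁ = a' by linear_combination hka]
    rcases hlb with hlb | hlb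
    · have hB' : ZMod.stdAddChar b - ZMod.stdAddChar b'
          = ZMod.stdAddChar (b - b₀) * (ZMod.stdAddChar b₀ - ZMod.stdAddChar b₁) := by
        rw [mul_sub, ← AddChar.map_add_eq_mul, ← AddChar.map_add_eq_mul, sub_add_cancel,
          show b - b₀ + b₁ = b' by linear_combination hlb]
      rw [hA', hB', mul_left_comm, ← h₀] at e'
      have hd := ZMod.injective_stdAddChar (mul_right_cancel₀ hA e')
      rw [show a - (a₀ - b₀) = b by linear_combination hd, hf₁ b,
        show b - (a₀ - a₁) = a' - (a₀ - b₀) by linear_combination hka - hd,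
        show b - (b₀ - b₁) = b' by linear_combination hlb]
    -- The reversed chord contributes a factor `-1`, absorbed as a translation by `h`.
    · have hB' : ZMod.stdAddChar b - ZMod.stdAddChar b'
          = ZMod.stdAddChar (b' - b₀ + h) * (ZMod.stdAddChar b₀ - ZMod.stdAddChar b₁) := by
        rw [AddChar.map_add_eq_mul, hhalf, mul_neg_one, neg_mul, mul_sub,
          ← AddChar.map_add_eq_mul, ← AddChar.map_add_eq_mul, sub_add_cancel,
          show b' - b₀ + b₁ = b by linear_combination -hlb]
        ring
      rw [hA', hB', mul_left_comm, ← h₀] at e'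
      have hd := ZMod.injective_stdAddChar (mul_right_cancel₀ hA e')
      rw [show a - (a₀ - b₀) = b + (b₀ - b₁) + h by linear_combination hd - hlb, hf₂ b,
        show b + (b₀ - b₁) + h - (a₀ - a₁) = a' - (a₀ - b₀) by
          linear_combination hka - hd + hlb,
        show b + (b₀ - b₁) = b' by linear_combination hlb]
  intro a b a' b' e
  have e' : ZMod.stdAddChar a - ZMod.stdAddChar a'
      = -s * (ZMod.stdAddChar b - ZMod.stdAddChar b') := by linear_combination e
  by_cases haa : a = a'
  · subst haa
    have : ZMod.stdAddChar b = ZMod.stdAddChar b' := by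
      rw [sub_self, zero_eq_mul, neg_eq_zero, or_iff_right hs0, sub_eq_zero] at e'
      exact e'
    rw [ZMod.injective_stdAddChar this]
  have hbb : b ≠ b' := by
    rintro rfl
    rw [sub_self, mul_zero, sub_eq_zero] at e'
    exact haa (ZMod.injective_stdAddChar e')
  have hnorm : ‖ZMod.stdAddChar a - ZMod.stdAddChar a'‖ * ‖ZMod.stdAddChar b₀ - ZMod.stdAddChar b₁‖
      = ‖ZMod.stdAddChar a₀ - ZMod.stdAddChar a₁‖
        * ‖ZMod.stdAddChar b - ZMod.stdAddChar b'‖ := by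
    rw [e', h₀, norm_mul, norm_mul]
    ring
  rcases eq_or_eq_of_norm_mul_eq (by omega) haa hb ha hbb hnorm with ⟨h1, h2⟩ | ⟨-, h2⟩
  · have h2' : b - b' = b₀ - b₁ ∨ b - b' = -(b₀ - b₁) :=
      h2.imp Eq.symm fun h => by rw [h, neg_neg]
    rcases h1 with h1 | h1
    · exact key a b a' b' e h1 h2'
    · refine (key a' b' a b e.symm (by linear_combination -h1) ?_).symm
      rcases h2' with h | h
      · exact Or.inr (by linear_combination -h)
      · exact Or.inl (by linear_combination -h)
  · exact absurd (h2.imp Eq.symm fun h => by rw [h, neg_neg]) hkl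

/-- Conjugation inverts unit complex numbers, so a nonzero sum determines the product, and with it
the two roots of a quadratic. -/
theorem eq_or_eq_of_add_eq_add {p q p' q' : ℂ} (hp : ‖p‖ = 1) (hq : ‖q‖ = 1) (hp' : ‖p'‖ = 1)
    (hq' : ‖q'‖ = 1) (h : p + q = p' + q') :
    p + q = 0 ∨ (p = p' ∧ q = q') ∨ (p = q' ∧ q = p') := by
  by_cases h0 : p + q = 0
  · exact Or.inl h0
  right
  have hconj := congrArg (starRingEnd ℂ) h
  rw [map_add, map_add, ← Complex.inv_eq_conj hp, ← Complex.inv_eq_conj hq,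
    ← Complex.inv_eq_conj hp', ← Complex.inv_eq_conj hq'] at hconj
  have p0 : p ≠ 0 := norm_ne_zero_iff.1 (by rw [hp]; exact one_ne_zero)
  have q0 : q ≠ 0 := norm_ne_zero_iff.1 (by rw [hq]; exact one_ne_zero)
  have p0' : p' ≠ 0 := norm_ne_zero_iff.1 (by rw [hp']; exact one_ne_zero)
  have q0' : q' ≠ 0 := norm_ne_zero_iff.1 (by rw [hq']; exact one_ne_zero)
  field_simp at hconj
  have hpq : p * q = p' * q' := by
    apply mul_left_cancel₀ h0
    linear_combination -hconj + p * q * h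
  have hroot : (p - p') * (p - q') = 0 := by
    linear_combination p * h - hpq
  rcases mul_eq_zero.1 hroot with h1 | h1
  · have := sub_eq_zero.1 h1
    exact Or.inl ⟨this, by linear_combination h - h1⟩
  · have := sub_eq_zero.1 h1
    exact Or.inr ⟨this, by linear_combination h - h1⟩

/-- The two chords have equal length, so their differences agree up to sign; then `-s` or `s` is a
quotient of powers of `ω`, and `-1` is such a power. -/
theorem exists_eq_stdAddChar_of_norm_eq_one (hn : 3 ≤ n) (s : ℂ) (hs : ‖s‖ = 1)
    {a₀ b₀ a₁ b₁ : ZMod (2 ^ n)} (ha : a₀ ≠ a₁) (hb : b₀ ≠ b₁)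
    (h₀ : ZMod.stdAddChar a₀ - ZMod.stdAddChar a₁
      = -s * (ZMod.stdAddChar b₀ - ZMod.stdAddChar b₁)) :
    ∃ m : ZMod (2 ^ n), s = ZMod.stdAddChar m := by
  have hB : ZMod.stdAddChar b₀ - ZMod.stdAddChar b₁ ≠ 0 := fun h =>
    hb (ZMod.injective_stdAddChar (sub_eq_zero.1 h))
  have hnorm : ‖ZMod.stdAddChar a₀ - ZMod.stdAddChar a₁‖
      = ‖ZMod.stdAddChar b₀ - ZMod.stdAddChar b₁‖ := by
    rw [h₀, norm_mul, norm_neg, hs, one_mul]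
  have hkl : a₀ - a₁ = b₀ - b₁ ∨ a₀ - a₁ = -(b₀ - b₁) := by
    rcases eq_or_eq_of_norm_mul_eq (by omega) ha ha hb hb (by rw [hnorm]) with h | h
    · exact h.1
    · exact h.1
  have hhalf := stdAddChar_half (n := n) (by omega)
  rcases hkl with h | h
  · refine ⟨a₀ - b₀ + 2 ^ (n - 1), mul_right_cancel₀ hB ?_⟩
    rw [AddChar.map_add_eq_mul, hhalf, mul_sub (_ * _), mul_right_comm,
      ← AddChar.map_add_eq_mul, mul_right_comm, ← AddChar.map_add_eq_mul, sub_add_cancel,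
      show a₀ - b₀ + b₁ = a₁ by linear_combination h]
    linear_combination h₀
  · refine ⟨a₀ - b₁, mul_right_cancel₀ hB ?_⟩
    rw [mul_sub (ZMod.stdAddChar _), ← AddChar.map_add_eq_mul, ← AddChar.map_add_eq_mul,
      sub_add_cancel, show a₀ - b₁ + b₀ = a₁ by linear_combination h]
    linear_combination h₀

/-- For a fade state on the unit circle, the bitwise sum is used. -/
theorem exists_resolves_stdAddChar (hn : 1 ≤ n) (m : ZMod (2 ^ n)) :
    ∃ f : ZMod (2 ^ n) → ZMod (2 ^ n) → (Fin n → Bool),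
      IsLatin f ∧ Resolves (ZMod.stdAddChar m) f := by
  choose χ hχ hχ' using fun i : Fin n => exists_digit n i i.2
  have hinj : ∀ x y, (∀ i, χ i x = χ i y) → x = y := by
    intro x y h
    by_contra hxy
    obtain ⟨i, hi, v, hv, e⟩ := exists_two_pow_mul_odd n (x - y) (sub_ne_zero.2 hxy)
    have h1 := hχ ⟨i, hi⟩ y v hv
    rw [← e, add_sub_cancel, h] at h1
    simp at h1
  have hhalf := stdAddChar_half (n := n) hn
  have hχh : ∀ i x, χ i (x + 2 ^ (n - 1)) = xor (χ i x) (decide (i.1 = n - 1)) := by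
    intro i x
    rw [two_pow_pred_eq]
    by_cases h : i.1 = n - 1
    · rw [← h, hχ i x 1 odd_one]
      simp
    · rw [hχ' i x (n - 1) 1 (by omega)]
      simp [h]
  refine ⟨fun a b i => xor (χ i a) (χ i (b + m)), ⟨fun b a a' e => hinj _ _ fun i => ?_,
    fun a b b' e => add_right_cancel (b := m) (hinj _ _ fun i => ?_)⟩, fun a b a' b' e => ?_⟩
  · simpa using congrFun e i
  · simpa using congrFun e i
  · rw [← AddChar.map_add_eq_mul, ← AddChar.map_add_eq_mul, add_comm m, add_comm m] at e
    have hzero : ∀ x y : ZMod (2 ^ n), ZMod.stdAddChar x + ZMod.stdAddChar y = 0 →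
        (fun i => xor (χ i x) (χ i y)) = fun i => decide (i.1 = n - 1) := by
      intro x y h
      have hy : y = x + 2 ^ (n - 1) := ZMod.injective_stdAddChar (by
        rw [AddChar.map_add_eq_mul, hhalf]
        linear_combination h)
      funext i
      rw [hy, hχh]
      simp
    change (fun i => xor (χ i a) (χ i (b + m))) = fun i => xor (χ i a') (χ i (b' + m))
    -- If the sums vanish, the two exponents of each pair differ by `2 ^ (n - 1)`, so both bitwise
    -- sums are the top bit alone. Otherwise the unordered pairs agree, and bitwise addition is
    -- commutative.
    rcases eq_or_eq_of_add_eq_add (norm_stdAddChar a) (norm_stdAddChar (b + m))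
      (norm_stdAddChar a') (norm_stdAddChar (b' + m)) e with h | ⟨h, h'⟩ | ⟨h, h'⟩
    · rw [hzero _ _ h, hzero _ _ (e ▸ h)]
    · rw [ZMod.injective_stdAddChar h, ZMod.injective_stdAddChar h']
    · funext i
      rw [ZMod.injective_stdAddChar h, ZMod.injective_stdAddChar h', Bool.xor_comm]

end Collisions

/-! ### The signal set -/

/-- The signal set is a rotated copy of the group of roots of unity of order `M`. -/
theorem exists_equiv_psk (M : ℕ) [NeZero M] :
    ∃ (z : ℂ) (φ : ZMod M ≃ psk M), z ≠ 0 ∧ ∀ a, (φ a : ℂ) = z * ZMod.stdAddChar a := by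
  let z : ℂ := Complex.exp ((Real.pi / M : ℝ) * Complex.I)
  have hz : z ≠ 0 := Complex.exp_ne_zero _
  have hval : ∀ m : ℕ, z * ZMod.stdAddChar ((m : ℕ) : ZMod M)
      = Complex.exp ((((2 * ((m + 1 : ℕ) : ℝ) - 1) * Real.pi / (M : ℝ) : ℝ) : ℂ)
        * Complex.I) := fun m => by
    have := ZMod.stdAddChar_coe (N := M) (m : ℤ)
    rw [Int.cast_natCast] at this
    rw [this, ← Complex.exp_add]
    congr 1
    push_cast
    ring
  have hmem : ∀ a : ZMod M, z * ZMod.stdAddChar a ∈ psk M := fun a =>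
    ⟨a.val + 1, Finset.mem_Icc.2 ⟨by omega, ZMod.val_lt a⟩, by
      rw [← hval, ZMod.natCast_zmod_val]⟩
  refine ⟨z, Equiv.ofBijective (fun a => ⟨z * ZMod.stdAddChar a, hmem a⟩) ⟨fun a b h => ?_, ?_⟩,
    hz, fun a => rfl⟩
  · exact ZMod.injective_stdAddChar (mul_left_cancel₀ hz (congrArg Subtype.val h))
  · rintro ⟨x, m, hm, rfl⟩
    have hm := Finset.mem_Icc.1 hm
    refine ⟨((m - 1 : ℕ) : ZMod M), Subtype.ext ?_⟩
    simp only [hval]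
    rw [Nat.sub_add_cancel hm.1]

/-! ### Latin squares and colourings -/

theorem exists_latinSquare_of_resolves {n : ℕ} {T : Type} [Fintype T]
    (hT : Fintype.card T = 2 ^ n) (s : ℂ) (f : ZMod (2 ^ n) → ZMod (2 ^ n) → T) (hf : IsLatin f)
    (hfs : Resolves s f) :
    ∃ L : LatinSquare (psk (2 ^ n)) (Fin (2 ^ n)), Function.Surjective L.entry ∧ L.Removes s := by
  obtain ⟨z, φ, hz, hφ⟩ := exists_equiv_psk (2 ^ n)
  let E : T ≃ Fin (2 ^ n) := Fintype.equivFinOfCardEq hT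
  refine ⟨⟨fun p => E (f (φ.symm p.1) (φ.symm p.2)), fun a b b' h e => h ?_,
    fun a a' b h e => h ?_⟩, fun t => ?_, fun c hc p hp q hq => ?_⟩
  · exact φ.symm.injective (hf.2 _ (E.injective e))
  · exact φ.symm.injective (hf.1 _ (E.injective e))
  -- A single row already contains every symbol, by counting.
  · have hbij : Function.Bijective (f 0) :=
      (Fintype.bijective_iff_injective_and_card _).2 ⟨hf.2 0, by rw [hT, ZMod.card]⟩
    obtain ⟨b, hb⟩ := hbij.2 (E.symm t)
    exact ⟨(φ 0, φ b), by simp [hb]⟩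
  · have h := hc.2.1 p hp q hq
    simp only [effectivePoint] at h
    refine congrArg E (hfs _ _ _ _ (mul_left_cancel₀ hz ?_))
    rw [← φ.apply_symm_apply p.1, ← φ.apply_symm_apply p.2, ← φ.apply_symm_apply q.1,
      ← φ.apply_symm_apply q.2] at h
    simp only [hφ] at h
    linear_combination h

theorem isRemovalConstraint_fibre (S : Set ℂ) (s : ℂ) (p : S × S) :
    IsRemovalConstraint S s {q | effectivePoint s q = effectivePoint s p} :=
  ⟨⟨p, rfl⟩, fun _ hq _ hr => hq.trans hr.symm, fun _ hq _ hr e => hr (e.symm.trans hq)⟩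

theorem IsRemovalConstraint.eq_of_mem {S : Set ℂ} {s : ℂ} {c d : Set (S × S)}
    (hc : IsRemovalConstraint S s c) (hd : IsRemovalConstraint S s d) {p : S × S} (hpc : p ∈ c)
    (hpd : p ∈ d) : c = d := by
  have key : ∀ {c d : Set (S × S)}, IsRemovalConstraint S s c → IsRemovalConstraint S s d →
      p ∈ c → p ∈ d → c ⊆ d := fun hc hd hpc hpd q hq => by
    by_contra hqd
    exact hd.2.2 p hpd q hqd (hc.2.1 p hpc q hq)
  exact (key hc hd hpc hpd).antisymm (key hd hc hpd hpc)

/-- A Latin square that removes `s` colours the singularity removal graph. -/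
theorem LatinSquare.exists_coloring {S : Set ℂ} {T : Type} (L : LatinSquare S T) {s : ℂ}
    (hL : Function.Surjective L.entry) (hs : L.Removes s) :
    ∃ C : (removalGraph S s).Coloring T, Function.Surjective C := by
  let color : RemovalConstraint S s → T := fun c => L.entry c.2.1.choose
  have hcolor : ∀ (c : RemovalConstraint S s), ∀ p ∈ c.1, color c = L.entry p := fun c p hp =>
    hs c.1 c.2 _ c.2.1.choose_spec p hp
  refine ⟨SimpleGraph.Coloring.mk color ?_, fun t => ?_⟩
  · rintro c d ⟨hne, p, hp, q, hq, h⟩ e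
    rw [hcolor c p hp, hcolor d q hq] at e
    have hpq : p ≠ q := by
      rintro rfl
      exact hne (Subtype.ext (c.2.eq_of_mem d.2 hp hq))
    obtain ⟨a, b⟩ := p
    obtain ⟨a', b'⟩ := q
    rcases h with h | h
    · simp only at h
      subst h
      exact L.row_exclusion a b b' (fun h => hpq (by rw [h])) e
    · simp only at h
      subst h
      exact L.col_exclusion a a' b (fun h => hpq (by rw [h])) e
  · obtain ⟨p, rfl⟩ := hL t
    exact ⟨⟨_, isRemovalConstraint_fibre S s p⟩, hcolor _ p rfl⟩

theorem exists_latinSquare_removes (n : ℕ) (hn : 3 ≤ n) (s : ℂ)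
    (hs : IsSingularFadeState (psk (2 ^ n)) s) :
    ∃ L : LatinSquare (psk (2 ^ n)) (Fin (2 ^ n)), Function.Surjective L.entry ∧ L.Removes s := by
  obtain ⟨z, φ, hz, hφ⟩ := exists_equiv_psk (2 ^ n)
  obtain ⟨hs0, ⟨x, y⟩, ⟨x', y'⟩, hne, h⟩ := hs
  obtain ⟨a₀, rfl⟩ := φ.surjective x
  obtain ⟨b₀, rfl⟩ := φ.surjective y
  obtain ⟨a₁, rfl⟩ := φ.surjective x'
  obtain ⟨b₁, rfl⟩ := φ.surjective y'
  simp only [effectivePoint, hφ] at h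
  have h₀ : ZMod.stdAddChar a₀ - ZMod.stdAddChar a₁
      = -s * (ZMod.stdAddChar b₀ - ZMod.stdAddChar b₁) := by
    apply mul_left_cancel₀ hz
    linear_combination h
  have hab : ¬ (a₀ = a₁ ∧ b₀ = b₁) := by
    rintro ⟨rfl, rfl⟩
    exact hne rfl
  have ha : a₀ ≠ a₁ := by
    rintro rfl
    rw [sub_self, zero_eq_mul, neg_eq_zero, or_iff_right hs0, sub_eq_zero] at h₀
    exact hab ⟨rfl, ZMod.injective_stdAddChar h₀⟩
  have hb : b₀ ≠ b₁ := by
    rintro rfl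
    rw [sub_self, mul_zero, sub_eq_zero] at h₀
    exact hab ⟨ZMod.injective_stdAddChar h₀, rfl⟩
  by_cases hs1 : ‖s‖ = 1
  · obtain ⟨m, rfl⟩ := exists_eq_stdAddChar_of_norm_eq_one hn s hs1 ha hb h₀
    obtain ⟨f, hf, hfs⟩ := exists_resolves_stdAddChar (by omega) m
    exact exists_latinSquare_of_resolves (by simp) _ f hf hfs
  · obtain ⟨f, hf, hfs⟩ := exists_resolves_of_norm_ne_one hn s hs1 ha hb h₀
    exact exists_latinSquare_of_resolves (ZMod.card _) _ f hf hfs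

end TwoWayRelay

theorem mainTheorem3 (l : ℕ) (hl : 3 ≤ l) (s : ℂ)
    (hs : TwoWayRelay.IsSingularFadeState (TwoWayRelay.psk (2 ^ l)) s) :
    (∃ L : TwoWayRelay.LatinSquare (TwoWayRelay.psk (2 ^ l)) (Fin (2 ^ l)),
      Function.Surjective L.entry ∧ L.Removes s) ∧
    (∃ C : (TwoWayRelay.removalGraph (TwoWayRelay.psk (2 ^ l)) s).Coloring (Fin (2 ^ l)),
      Function.Surjective C) := by
  obtain ⟨L, hL, hLs⟩ := TwoWayRelay.exists_latinSquare_removes l hl s hs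
  exact ⟨⟨L, hL, hLs⟩, L.exists_coloring hL hLs⟩
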